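/- Let $\mathbb{F}_q$ be a finite field and let $0\le m\le n$ be integers. A real function $f$ on the vertices of a finite graph $G$ is a $\lambda$-eigenfunction of $G$ if $f\not\equiv 0$ and $\lambda f(x)=\sum_{y\sim x}f(y)$ for every vertex $x$. The bilinear forms graph $\mathrm{Bil}_q(n,m)$ has all $n\times m$ matrices over $\mathbb{F}_q$ as vertices, two matrices being adjacent when their difference has rank $1$. The Grassmann graph $J_q(n+m,m)$ has all $m$-dimensional subspaces of an $(n+m)$-dimensional vector space $V$ over $\mathbb{F}_q$ as vertices, two subspaces being adjacent when their intersection has dimension $m-1$. Let $W\le V$ be a subspace of dimension $n$, let $w_1,\dots,w_n,u_1,\dots,u_m$ be a basis of $V$ whose first $n$ vectors span $W$, and for an $n\times m$ matrix $M=(M_{ij})$ put $$\overline{M}=\Big\langle u_j+\sum_{i=1}^n M_{ij}w_i \;:\; j=1,\dots,m\Big\rangle .$$ The map $M\mapsto\overline{M}$ is an isomorphism of $\mathrm{Bil}_q(n,m)$ onto the subgraph of $J_q(n+m,m)$ induced on the $m$-dimensional subspaces $U$ with $U\cap W=0$. Let $\lambda_D$ be the minimum eigenvalue of $\mathrm{Bil}_q(n,m)$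 and let $f$ be a $\lambda_D$-eigenfunction of $\mathrm{Bil}_q(n,m)$. Define $\widehat f$ on the $m$-dimensional subspaces of $V$ by $\widehat f(\overline{M})=f(M)$ for every $n\times m$ matrix $M$, and $\widehat f(U)=0$ if $U\cap W\neq 0$. Then $\lambda_D$ is also the minimum eigenvalue of the Grassmann graph $J_q(n+m,m)$, and $\widehat f$ is a $\lambda_D$-eigenfunction of $J_q(n+m,m)$. -/

import Mathlib

open Module

/-- `f` is a `θ`-eigenfunction of the finite graph `G`: a real function on the vertices which is not
identically zero and satisfies `θ * f x = ∑ f y`, summed over the neighbours `y` of `x`, at every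
vertex `x`. -/
def IsEigenfunction {X : Type*} [Finite X] (G : SimpleGraph X) (θ : ℝ) (f : X → ℝ) : Prop :=
  f ≠ 0 ∧ ∀ x : X, θ * f x = ∑ᶠ y ∈ G.neighborSet x, f y

/-- `θ` is the minimum eigenvalue of the finite graph `G`. -/
def IsMinEigenvalue {X : Type*} [Finite X] (G : SimpleGraph X) (θ : ℝ) : Prop :=
  IsLeast {μ : ℝ | ∃ f : X → ℝ, IsEigenfunction G μ f} θ

/-- The bilinear forms graph `Bil_q(n, m)`, `q = |F|`: the vertices are the `n × m` matrices over
`F`, two of them adjacent when their difference has rank `1`. -/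
def bilinearFormsGraph (F : Type*) [Field F] (n m : ℕ) :
    SimpleGraph (Matrix (Fin n) (Fin m) F) where
  Adj A B := (A - B).rank = 1
  symm := ⟨fun A B h => by
    have e : LinearMap.range (B - A).mulVecLin = LinearMap.range (A - B).mulVecLin := by
      rw [← neg_sub A B]
      have : (-(A - B)).mulVecLin = -(A - B).mulVecLin := by
        ext1; simp
      rw [this, LinearMap.range_neg]
    unfold Matrix.rank at h ⊢
    rw [e, h]⟩
  loopless := ⟨fun A h => by simp at h⟩

/-- The `m`-dimensional subspaces of `V`. -/
abbrev MSubspace (F V : Type*) [Field F] [AddCommGroup V] [Module F V] (m : ℕ) : Type _ :=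
  {U : Submodule F V // finrank F U = m}

instance MSubspace.instFinite (F V : Type*) [Field F] [AddCommGroup V] [Module F V] [Finite V]
    (m : ℕ) : Finite (MSubspace F V m) :=
  have : Finite (Submodule F V) := Finite.of_injective _ SetLike.coe_injective
  inferInstance

/-- The Grassmann graph on the `m`-dimensional subspaces of `V`: two of them are adjacent when
their intersection has dimension `m - 1`. This is `J_q(N, m)` if `V` has dimension `N` over
the field `F` of order `q`. -/
def grassmannGraph (F V : Type*) [Field F] [AddCommGroup V] [Module F V] (m : ℕ) :
    SimpleGraph (MSubspace F V m) where
  Adj U U' := finrank F (U.1 ⊓ U'.1 : Submodule F V) + 1 = m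
  symm := ⟨fun U U' h => by rwa [inf_comm]⟩
  loopless := ⟨fun U h => by
    rw [inf_idem, U.2] at h
    omega⟩

section Embedding

variable {F V : Type*} [Field F] [AddCommGroup V] [Module F V] {n m : ℕ}

/-- Identify `V` with `Fⁿ × Fᵐ` by means of the basis `b`. -/
noncomputable def splitCoords (b : Basis (Fin n ⊕ Fin m) F V) :
    V ≃ₗ[F] (Fin n → F) × (Fin m → F) :=
  b.equivFun.trans (LinearEquiv.sumArrowLequivProdArrow (Fin n) (Fin m) F F)

/-- The injective linear map `Fᵐ → V`, `x ↦ (M x, x)`, in the coordinates given by `b`. -/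
noncomputable def graphMap (b : Basis (Fin n ⊕ Fin m) F V) (M : Matrix (Fin n) (Fin m) F) :
    (Fin m → F) →ₗ[F] V :=
  (splitCoords b).symm.toLinearMap ∘ₗ (M.mulVecLin.prod LinearMap.id)

theorem splitCoords_graphMap (b : Basis (Fin n ⊕ Fin m) F V) (M : Matrix (Fin n) (Fin m) F)
    (x : Fin m → F) : splitCoords b (graphMap b M x) = (M.mulVec x, x) := by
  simp [graphMap]

theorem graphMap_injective (b : Basis (Fin n ⊕ Fin m) F V) (M : Matrix (Fin n) (Fin m) F) :
    Function.Injective (graphMap b M) := fun x y h => by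
  have := congrArg (splitCoords b) h
  rw [splitCoords_graphMap, splitCoords_graphMap] at this
  exact (Prod.mk.inj this).2

/-- The `m`-dimensional subspace `M̄ = {(M x, x) : x ∈ Fᵐ}` of `V` that represents the `n × m`
matrix `M`, in the coordinates given by `b`. -/
noncomputable def matrixSubspace (b : Basis (Fin n ⊕ Fin m) F V) (M : Matrix (Fin n) (Fin m) F) :
    MSubspace F V m :=
  ⟨LinearMap.range (graphMap b M), by
    rw [LinearMap.finrank_range_of_inj (graphMap_injective b M)]; simp⟩

theorem mem_matrixSubspace (b : Basis (Fin n ⊕ Fin m) F V) (M : Matrix (Fin n) (Fin m) F)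
    (v : V) : v ∈ (matrixSubspace b M).1 ↔
      (splitCoords b v).1 = M.mulVec (splitCoords b v).2 := by
  constructor
  · rintro ⟨x, rfl⟩
    simp [splitCoords_graphMap]
  · intro h
    refine ⟨(splitCoords b v).2, (splitCoords b).injective ?_⟩
    rw [splitCoords_graphMap, ← h]

theorem matrixSubspace_injective (b : Basis (Fin n ⊕ Fin m) F V) :
    Function.Injective (matrixSubspace b) := fun M N h => by
  apply Matrix.ext_of_mulVec_single
  intro j
  have h1 : graphMap b M (Pi.single j 1) ∈ (matrixSubspace b N).1 := by
    rw [← h]; exact ⟨_, rfl⟩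
  rw [mem_matrixSubspace, splitCoords_graphMap] at h1
  exact h1

theorem mem_span_inl (b : Basis (Fin n ⊕ Fin m) F V) (v : V) :
    v ∈ Submodule.span F (Set.range fun i => b (Sum.inl i)) ↔ (splitCoords b v).2 = 0 := by
  have : (Set.range fun i => b (Sum.inl i)) = b '' Set.range Sum.inl := by
    rw [← Set.range_comp]; rfl
  rw [this, Basis.mem_span_image]
  constructor
  · intro h
    funext j
    by_contra hj
    have : Sum.inr j ∈ Set.range (Sum.inl : Fin n → Fin n ⊕ Fin m) := by
      apply h
      simpa [splitCoords] using hj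
    simp at this
  · rintro h (i | j) hi
    · exact ⟨i, rfl⟩
    · have := congrFun h j
      simp [splitCoords] at this hi
      exact absurd this hi

/-- If the first `n` vectors of `b` span `W`, then the subspaces `M̄` are exactly the
`m`-dimensional subspaces that meet `W` trivially. -/
theorem range_matrixSubspace (b : Basis (Fin n ⊕ Fin m) F V) (W : Submodule F V)
    (hW : Submodule.span F (Set.range fun i => b (Sum.inl i)) = W) (U : MSubspace F V m) :
    (∃ M, matrixSubspace b M = U) ↔ U.1 ⊓ W = ⊥ := by
  subst hW
  constructor
  · rintro ⟨M, rfl⟩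
    rw [eq_bot_iff]
    rintro v ⟨h1, h2⟩
    rw [SetLike.mem_coe, mem_matrixSubspace] at h1
    rw [SetLike.mem_coe, mem_span_inl] at h2
    rw [Submodule.mem_bot, ← (splitCoords b).map_eq_zero_iff]
    rw [h2, Matrix.mulVec_zero] at h1
    exact Prod.ext h1 h2
  · intro h
    have : Module.Finite F V := Module.Finite.of_basis b
    let p : U.1 →ₗ[F] (Fin m → F) :=
      LinearMap.snd F _ _ ∘ₗ (splitCoords b).toLinearMap ∘ₗ U.1.subtype
    have hp : Function.Injective p := by
      rw [injective_iff_map_eq_zero]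
      rintro ⟨v, hv⟩ hpv
      have : v ∈ U.1 ⊓ Submodule.span F (Set.range fun i => b (Sum.inl i)) :=
        ⟨hv, (mem_span_inl b v).2 hpv⟩
      rw [h, Submodule.mem_bot] at this
      exact Subtype.ext this
    let e := LinearMap.linearEquivOfInjective p hp (by rw [U.2]; simp)
    refine ⟨LinearMap.toMatrix' (LinearMap.fst F _ _ ∘ₗ (splitCoords b).toLinearMap ∘ₗ
      U.1.subtype ∘ₗ e.symm.toLinearMap), Subtype.ext ?_⟩
    symm
    apply Submodule.eq_of_le_of_finrank_eq
    · intro v hv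
      rw [mem_matrixSubspace, LinearMap.toMatrix'_mulVec]
      have : e.symm (splitCoords b v).2 = ⟨v, hv⟩ := by
        rw [LinearEquiv.symm_apply_eq]
        rfl
      simp [this]
    · rw [U.2, (matrixSubspace b _).2]

theorem matrixSubspace_adj (b : Basis (Fin n ⊕ Fin m) F V) (M N : Matrix (Fin n) (Fin m) F) :
    (grassmannGraph F V m).Adj (matrixSubspace b M) (matrixSubspace b N) ↔
      (bilinearFormsGraph F n m).Adj M N := by
  have key : ((matrixSubspace b M).1 ⊓ (matrixSubspace b N).1 : Submodule F V) =
      (LinearMap.ker (M - N).mulVecLin).map (graphMap b M) := by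
    ext v
    rw [Submodule.mem_inf, Submodule.mem_map]
    constructor
    · rintro ⟨⟨x, rfl⟩, h⟩
      rw [mem_matrixSubspace, splitCoords_graphMap] at h
      refine ⟨x, ?_, rfl⟩
      rw [LinearMap.mem_ker, Matrix.mulVecLin_apply, Matrix.sub_mulVec, sub_eq_zero]
      exact h
    · rintro ⟨x, hx, rfl⟩
      refine ⟨⟨x, rfl⟩, ?_⟩
      rw [LinearMap.mem_ker, Matrix.mulVecLin_apply, Matrix.sub_mulVec, sub_eq_zero] at hx
      rw [mem_matrixSubspace, splitCoords_graphMap]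
      exact hx
  have h1 := (M - N).mulVecLin.finrank_range_add_finrank_ker
  rw [Module.finrank_fin_fun] at h1
  change finrank F ((matrixSubspace b M).1 ⊓ (matrixSubspace b N).1 : Submodule F V) + 1 = m ↔
    finrank F (LinearMap.range (M - N).mulVecLin) = 1
  rw [key, (Submodule.equivMapOfInjective _ (graphMap_injective b M) _).symm.finrank_eq]
  omega

/-- The identification of `Bil_q(n, m)` with the subgraph of the Grassmann graph induced on the
`m`-dimensional subspaces that meet `W` trivially, given by `M ↦ M̄`. Here `b` is a basis of `V`
whose first `n` vectors span `W`. -/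
noncomputable def bilinearFormsIso (b : Basis (Fin n ⊕ Fin m) F V) (W : Submodule F V)
    (hW : Submodule.span F (Set.range fun i => b (Sum.inl i)) = W) :
    bilinearFormsGraph F n m ≃g
      (grassmannGraph F V m).induce {U : MSubspace F V m | U.1 ⊓ W = ⊥} where
  toEquiv := Equiv.ofBijective
    (fun M => ⟨matrixSubspace b M, (range_matrixSubspace b W hW _).1 ⟨M, rfl⟩⟩)
    ⟨fun _ _ h => matrixSubspace_injective b (congrArg Subtype.val h),
      fun U => ((range_matrixSubspace b W hW U.1).2 U.2).imp fun _ h => Subtype.ext h⟩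
  map_rel_iff' := matrixSubspace_adj b _ _

open Classical in
/-- The extension `f̂` by zero of a function `f` on the vertices of `Bil_q(n, m)`: its value at
`M̄` is `f M`, and it vanishes at the `m`-dimensional subspaces that meet `W` nontrivially. -/
noncomputable def zeroExtension (b : Basis (Fin n ⊕ Fin m) F V) (W : Submodule F V)
    (hW : Submodule.span F (Set.range fun i => b (Sum.inl i)) = W)
    (f : Matrix (Fin n) (Fin m) F → ℝ) (U : MSubspace F V m) : ℝ :=
  if hU : U.1 ⊓ W = ⊥ then f ((bilinearFormsIso b W hW).symm ⟨U, hU⟩) else 0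

end Embedding

/-!
Let `N` be the incidence matrix of the `(m-1)`-dimensional versus the `m`-dimensional subspaces of
`V` and let `k` be the number of hyperplanes of an `m`-dimensional space. Two different
`m`-dimensional subspaces contain at most one `(m-1)`-dimensional subspace in common, so the
adjacency matrix `A` of the Grassmann graph satisfies `Nᵀ N = A + k I` (`sum_upSum`). Hence every
eigenvalue is at least `-k`, and `A g = -k g` as soon as `N g = 0`.

The value `-k` is attained, and already on the bilinear forms graph: if the values of `φ : F → ℝ`
add up to `0` and `m ≤ n`, then the extension by zero of `M ↦ φ (M₁₁ + ⋯ + Mₘₘ)` is in the kernel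
of `N`. Indeed, the subspaces `U` containing a given `(m-1)`-dimensional `H` are permuted by
shears of `V` which fix `H` and `W` pointwise and which act on the `M̄` as `M ↦ M + c x yᵀ`, `c ∈ F`.
Here `y ≠ 0` has to annihilate the last `m` coordinates of the vectors of `H`, which is possible
because `H` has dimension `m - 1`; the column `x` can be chosen with `∑ xᵢ yᵢ ≠ 0` because `m ≤ n`,
and then the sum over `c` is zero for each `U` (`upSum_zeroExtension_diagFun`). As the bilinear forms graph is an
induced subgraph, `M ↦ φ (M₁₁ + ⋯ + Mₘₘ)` is a `-k`-eigenfunction of it (`isEigenfunction_diagFun`).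

So the minimum eigenvalue `θ` of the bilinear forms graph is at most `-k`. If `f` is a
`θ`-eigenfunction and `g` is its extension by zero, then
`‖N g‖² = ⟨g, (A + k I) g⟩ = (θ + k) ‖g‖² ≤ 0`, where the second equality uses the eigenvalue
equation at the subspaces `M̄` only, as `g` vanishes at the others. Therefore `N g = 0`, so that `g` is a
`-k`-eigenfunction of the Grassmann graph, and comparing values at some `M̄` gives `θ = -k`.
-/

open scoped Classical in
theorem isEigenfunction_iff_sum {X : Type*} [Fintype X] (G : SimpleGraph X) (θ : ℝ) (f : X → ℝ) :
    IsEigenfunction G θ f ↔ f ≠ 0 ∧ ∀ x, θ * f x = ∑ y, if G.Adj x y then f y else 0 := by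
  have h (x : X) : ∑ᶠ y ∈ G.neighborSet x, f y = ∑ y, if G.Adj x y then f y else 0 := by
    rw [finsum_eq_sum_of_fintype]
    refine Finset.sum_congr rfl fun y _ => ?_
    rw [finsum_eq_if]
    rfl
  simp only [IsEigenfunction, h]

/-! ### The incidence matrix of the Grassmann graph -/

section Grassmann

variable {F V : Type*} [Field F] [AddCommGroup V] [Module F V] {m : ℕ}

/-- The subspaces of dimension `m - 1`. The equation `finrank F H + 1 = m` has no solution
for `m = 0`, so the type is empty in that case. -/
abbrev CoSubspace (F V : Type*) [Field F] [AddCommGroup V] [Module F V] (m : ℕ) : Type _ :=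
  {H : Submodule F V // finrank F H + 1 = m}

/-- The number of hyperplanes of an `m`-dimensional space over `F`, that is
`(q ^ m - 1) / (q - 1)` if `F` has order `q`. Its value plays no role. -/
noncomputable def hyperplaneCount (F : Type*) [Field F] (m : ℕ) : ℕ :=
  Nat.card (CoSubspace F (Fin m → F) m)

theorem card_coSubspace_le [Finite V] (U : MSubspace F V m) :
    Nat.card {H : CoSubspace F V m // H.1 ≤ U.1} = hyperplaneCount F m := by
  have e : (Fin m → F) ≃ₗ[F] U.1 := LinearEquiv.ofFinrankEq _ _ (by rw [U.2]; simp)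
  let o : Submodule F (Fin m → F) ≃ {H : Submodule F V // H ≤ U.1} :=
    ((Submodule.orderIsoMapComap e).trans (Submodule.mapIic U.1)).toEquiv
  have ho (K : Submodule F (Fin m → F)) : finrank F (o K).1 = finrank F K := by
    have : (o K).1 = (K.map e.toLinearMap).map U.1.subtype := rfl
    rw [this, Submodule.finrank_map_subtype_eq]
    exact LinearEquiv.finrank_map_eq e K
  refine Nat.card_congr (Equiv.trans ?_ (o.subtypeEquiv
    (q := fun H => finrank F H.1 + 1 = m) fun K => by rw [ho]).symm)
  exact (Equiv.subtypeSubtypeEquivSubtypeInter _ _).trans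
    ((Equiv.subtypeEquivRight fun _ => and_comm).trans
      (Equiv.subtypeSubtypeEquivSubtypeInter (fun H => H ≤ U.1) _).symm)

open scoped Classical in
/-- Two different `m`-dimensional subspaces have at most one `(m-1)`-dimensional subspace in
common, and they have one exactly when they are adjacent in the Grassmann graph. -/
theorem card_coSubspace_le_le [Finite V] {U U' : MSubspace F V m} (hne : U ≠ U') :
    Nat.card {H : CoSubspace F V m // H.1 ≤ U.1 ∧ H.1 ≤ U'.1} =
      if (grassmannGraph F V m).Adj U U' then 1 else 0 := by
  have hlt : finrank F (U.1 ⊓ U'.1 : Submodule F V) < m := by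
    refine (Submodule.finrank_lt_finrank_of_lt
      (lt_of_le_of_ne inf_le_left fun h => hne ?_)).trans_eq U.2
    exact Subtype.ext (Submodule.eq_of_le_of_finrank_eq (inf_eq_left.1 h) (U.2.trans U'.2.symm))
  -- the dimensions leave `U ⊓ U'` as the only candidate
  have key {H : Submodule F V} (hH : finrank F H + 1 = m) (hU : H ≤ U.1) (hU' : H ≤ U'.1) :
      H = U.1 ⊓ U'.1 := by
    have hle := le_inf hU hU'
    have := Submodule.finrank_mono hle
    exact Submodule.eq_of_le_of_finrank_eq hle (by omega)
  split_ifs with h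
  · rw [Nat.card_eq_one_iff_exists]
    refine ⟨⟨⟨_, h⟩, inf_le_left, inf_le_right⟩, ?_⟩
    rintro ⟨⟨H, hH⟩, hU, hU'⟩
    exact Subtype.ext (Subtype.ext (key hH hU hU'))
  · rw [Nat.card_eq_zero]
    refine Or.inl ⟨?_⟩
    rintro ⟨⟨H, hH⟩, hU, hU'⟩
    obtain rfl := key hH hU hU'
    exact h hH

variable [Fintype (MSubspace F V m)]

open scoped Classical in
/-- The sum of `f` over the `m`-dimensional subspaces that contain `H`: the action on `f` of the
incidence matrix of `(m-1)`-dimensional versus `m`-dimensional subspaces. -/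
noncomputable def upSum (f : MSubspace F V m → ℝ) (H : Submodule F V) : ℝ :=
  ∑ U : MSubspace F V m, if H ≤ U.1 then f U else 0

variable [Fintype (CoSubspace F V m)]

open scoped Classical in
/-- If `N` is the incidence matrix of `(m-1)`-dimensional versus `m`-dimensional subspaces and
`A` the adjacency matrix of the Grassmann graph, then `Nᵀ N = k I + A`, where `k` is the number
of hyperplanes of an `m`-dimensional space. -/
theorem sum_upSum [Finite V] (f : MSubspace F V m → ℝ) (U : MSubspace F V m) :
    (∑ H : CoSubspace F V m, if H.1 ≤ U.1 then upSum f H.1 else 0) =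
      hyperplaneCount F m * f U +
        ∑ U', if (grassmannGraph F V m).Adj U U' then f U' else 0 := by
  have h1 : (∑ H : CoSubspace F V m, if H.1 ≤ U.1 then upSum f H.1 else 0) =
      ∑ U' : MSubspace F V m,
        (Nat.card {H : CoSubspace F V m // H.1 ≤ U.1 ∧ H.1 ≤ U'.1} : ℝ) * f U' := by
    have (H : CoSubspace F V m) : (if H.1 ≤ U.1 then upSum f H.1 else 0) =
        ∑ U' : MSubspace F V m, if H.1 ≤ U.1 ∧ H.1 ≤ U'.1 then f U' else 0 := by
      by_cases h : H.1 ≤ U.1 <;> simp [h, upSum]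
    rw [Finset.sum_congr rfl fun H _ => this H, Finset.sum_comm]
    refine Finset.sum_congr rfl fun U' _ => ?_
    rw [← Finset.sum_filter, Finset.sum_const, nsmul_eq_mul, Nat.card_eq_fintype_card,
      Fintype.card_subtype]
  have h2 (U' : MSubspace F V m) :
      (Nat.card {H : CoSubspace F V m // H.1 ≤ U.1 ∧ H.1 ≤ U'.1} : ℝ) * f U' =
        (if U' = U then hyperplaneCount F m * f U else 0) +
          if (grassmannGraph F V m).Adj U U' then f U' else 0 := by
    by_cases h : U' = U
    · subst h
      simp only [and_self, card_coSubspace_le, if_true, SimpleGraph.irrefl, if_false, add_zero]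
    · rw [card_coSubspace_le_le (Ne.symm h), if_neg h, zero_add]
      split_ifs <;> simp
  rw [h1, Finset.sum_congr rfl fun U' _ => h2 U', Finset.sum_add_distrib]
  simp

open scoped Classical in
/-- The quadratic form of `A + k I` is `f ↦ ‖N f‖²`, in the notation of `sum_upSum`. -/
theorem sum_upSum_sq [Finite V] (f : MSubspace F V m → ℝ) :
    ∑ H : CoSubspace F V m, upSum f H.1 ^ 2 =
      ∑ U, f U * (hyperplaneCount F m * f U +
        ∑ U', if (grassmannGraph F V m).Adj U U' then f U' else 0) := by
  simp only [← sum_upSum, Finset.mul_sum]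
  rw [Finset.sum_comm]
  refine Finset.sum_congr rfl fun H _ => ?_
  rw [sq]
  nth_rw 1 [upSum]
  rw [Finset.sum_mul]
  refine Finset.sum_congr rfl fun U _ => ?_
  split_ifs <;> simp

/-- The eigenvalues of the Grassmann graph are bounded below by minus the number of hyperplanes
of an `m`-dimensional space. -/
theorem neg_hyperplaneCount_le_of_isEigenfunction [Finite V] {μ : ℝ} {f : MSubspace F V m → ℝ}
    (hf : IsEigenfunction (grassmannGraph F V m) μ f) : -(hyperplaneCount F m : ℝ) ≤ μ := by
  classical
  rw [isEigenfunction_iff_sum] at hf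
  obtain ⟨hf0, hf⟩ := hf
  have h := sum_upSum_sq f
  simp only [← hf, ← add_mul, mul_left_comm (f _), ← Finset.mul_sum] at h
  have h0 : 0 ≤ ∑ H : CoSubspace F V m, upSum f H.1 ^ 2 := Finset.sum_nonneg fun _ _ => sq_nonneg _
  have hpos : 0 < ∑ U, f U * f U := by
    obtain ⟨U, hU⟩ := Function.ne_iff.1 hf0
    exact Finset.sum_pos' (fun _ _ => mul_self_nonneg _) ⟨U, Finset.mem_univ _, mul_self_pos.2 hU⟩
  rw [h] at h0
  have := nonneg_of_mul_nonneg_left h0 hpos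
  linarith

end Grassmann

/-! ### The extension by zero -/

section ZeroExtension

variable {F V : Type*} [Field F] [AddCommGroup V] [Module F V] {n m : ℕ}
  (b : Basis (Fin n ⊕ Fin m) F V) {W : Submodule F V}
  (hW : Submodule.span F (Set.range fun i => b (Sum.inl i)) = W)

theorem zeroExtension_matrixSubspace (f : Matrix (Fin n) (Fin m) F → ℝ)
    (M : Matrix (Fin n) (Fin m) F) : zeroExtension b W hW f (matrixSubspace b M) = f M := by
  have h : (matrixSubspace b M).1 ⊓ W = ⊥ := (range_matrixSubspace b W hW _).1 ⟨M, rfl⟩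
  rw [zeroExtension, dif_pos h]
  congr 1
  rw [RelIso.symm_apply_eq]
  rfl

theorem zeroExtension_of_inf_ne_bot (f : Matrix (Fin n) (Fin m) F → ℝ) {U : MSubspace F V m}
    (hU : U.1 ⊓ W ≠ ⊥) : zeroExtension b W hW f U = 0 :=
  dif_neg hU

theorem zeroExtension_ne_zero {f : Matrix (Fin n) (Fin m) F → ℝ} (hf : f ≠ 0) :
    zeroExtension b W hW f ≠ 0 := by
  obtain ⟨M, hM⟩ := Function.ne_iff.1 hf
  refine Function.ne_iff.2 ⟨matrixSubspace b M, ?_⟩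
  rwa [zeroExtension_matrixSubspace]

variable [Fintype (MSubspace F V m)] [Fintype (Matrix (Fin n) (Fin m) F)]

open scoped Classical in
/-- At a vertex `M̄` the neighbour sums of `f̂` in the Grassmann graph are those of `f` in the
bilinear forms graph. -/
theorem sum_adj_zeroExtension (f : Matrix (Fin n) (Fin m) F → ℝ) (M : Matrix (Fin n) (Fin m) F) :
    (∑ U, if (grassmannGraph F V m).Adj (matrixSubspace b M) U then
      zeroExtension b W hW f U else 0) =
      ∑ M', if (bilinearFormsGraph F n m).Adj M M' then f M' else 0 := by
  symm
  refine Finset.sum_of_injOn (matrixSubspace b) (matrixSubspace_injective b).injOn (by simp)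
    (fun U _ hU => ?_) fun M' _ => ?_
  · rw [zeroExtension_of_inf_ne_bot, ite_self]
    rw [Ne, ← range_matrixSubspace b W hW]
    simpa using hU
  · simp only [matrixSubspace_adj, zeroExtension_matrixSubspace]

end ZeroExtension

/-! ### An eigenfunction of the bilinear forms graph -/

section Diagonal

variable {F V : Type*} [Field F] [AddCommGroup V] [Module F V] {n m : ℕ}

open scoped Classical in
/-- The function `M ↦ φ (M₁₁ + ⋯ + Mₘₘ)` on the `n × m` matrices, `m ≤ n`, where `φ 0 = q - 1` and
`φ t = -1` for `t ≠ 0`, so that the values of `φ` on `F` add up to `0`. -/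
noncomputable def diagFun (F : Type*) [Field F] (hmn : m ≤ n) (M : Matrix (Fin n) (Fin m) F) : ℝ :=
  (if ∑ j, M (Fin.castLE hmn j) j = 0 then (Nat.card F : ℝ) else 0) - 1

theorem diagFun_ne_zero [Finite F] (hmn : m ≤ n) : diagFun F hmn ≠ 0 := by
  refine Function.ne_iff.2 ⟨0, ?_⟩
  have : 1 < Nat.card F := Finite.one_lt_card
  have : (1 : ℝ) < Nat.card F := by exact_mod_cast this
  simp [diagFun]
  linarith

/-- The argument of `φ` changes by `c * y j`, which runs through `F` together with `c`. -/
theorem sum_diagFun_add_smul [Fintype F] (hmn : m ≤ n) (M : Matrix (Fin n) (Fin m) F)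
    {y : Fin m → F} {j : Fin m} (hj : y j ≠ 0) :
    ∑ c : F, diagFun F hmn (M + c • Matrix.vecMulVec (Pi.single (Fin.castLE hmn j) 1) y) = 0 := by
  classical
  have h (c : F) : ∑ i, (M + c • Matrix.vecMulVec (Pi.single (Fin.castLE hmn j) 1) y)
      (Fin.castLE hmn i) i = 0 ↔ c = -(∑ i, M (Fin.castLE hmn i) i) / y j := by
    have (i : Fin m) : (M + c • Matrix.vecMulVec (Pi.single (Fin.castLE hmn j) 1) y)
        (Fin.castLE hmn i) i = M (Fin.castLE hmn i) i + if i = j then c * y j else 0 := by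
      by_cases hij : i = j
      · subst hij; simp [Matrix.vecMulVec_apply]
      · simp [Matrix.vecMulVec_apply, hij]
    rw [Finset.sum_congr rfl fun i _ => this i, Finset.sum_add_distrib, Finset.sum_ite_eq',
      if_pos (Finset.mem_univ _), eq_div_iff hj, eq_neg_iff_add_eq_zero, add_comm]
  simp only [diagFun, h, Finset.sum_sub_distrib]
  simp

/-! ### Shears -/

variable (b : Basis (Fin n ⊕ Fin m) F V)

/-- The map `v ↦ v + (y ⬝ p v) x` of `V`, where `p v` are the last `m` coordinates of `v` and `x`
is regarded as a vector of `W`. -/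
noncomputable def shear (x : Fin n → F) (y : Fin m → F) : V ≃ₗ[F] V :=
  LinearEquiv.transvection
    (f := dotProductBilin F F y ∘ₗ LinearMap.snd F (Fin n → F) _ ∘ₗ (splitCoords b).toLinearMap)
    (v := (splitCoords b).symm (x, 0)) (by simp)

theorem shear_apply (x : Fin n → F) (y : Fin m → F) (v : V) :
    shear b x y v = v + (y ⬝ᵥ (splitCoords b v).2) • (splitCoords b).symm (x, 0) :=
  rfl

theorem shear_apply_of_dotProduct_eq_zero (x : Fin n → F) {y : Fin m → F} {v : V}
    (h : y ⬝ᵥ (splitCoords b v).2 = 0) : shear b x y v = v := by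
  rw [shear_apply, h, zero_smul, add_zero]

/-- A shear acts on the subspaces `M̄` as the translation by a matrix of rank at most `1`. -/
theorem map_shear_matrixSubspace (x : Fin n → F) (y : Fin m → F) (M : Matrix (Fin n) (Fin m) F) :
    (matrixSubspace b M).1.map (shear b x y).toLinearMap =
      (matrixSubspace b (M + Matrix.vecMulVec x y)).1 := by
  change (LinearMap.range (graphMap b M)).map _ = LinearMap.range (graphMap b _)
  rw [← LinearMap.range_comp]
  congr 1
  ext1 j
  ext1
  apply (splitCoords b).injective
  ext i <;> simp [shear_apply, splitCoords_graphMap, Matrix.vecMulVec_apply, mul_comm]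

/-- The permutation of the `m`-dimensional subspaces induced by a linear automorphism. -/
noncomputable def mapMSubspace (e : V ≃ₗ[F] V) : MSubspace F V m ≃ MSubspace F V m :=
  (Submodule.orderIsoMapComap e).toEquiv.subtypeEquiv fun U => by
    change _ ↔ finrank F (U.map e.toLinearMap) = m
    rw [LinearEquiv.finrank_map_eq]

theorem map_eq_self_of_forall_apply_eq {e : V ≃ₗ[F] V} {H : Submodule F V}
    (h : ∀ v ∈ H, e v = v) : H.map e.toLinearMap = H := by
  ext v
  rw [Submodule.mem_map]
  exact ⟨by rintro ⟨u, hu, rfl⟩; rwa [LinearEquiv.coe_coe, h u hu], fun hv => ⟨v, hv, h v hv⟩⟩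

variable {W : Submodule F V} (hW : Submodule.span F (Set.range fun i => b (Sum.inl i)) = W)

/-- The shears along multiples of a suitable vector of `W` permute the subspaces `M̄`, and also the
remaining `m`-dimensional subspaces; the values of the extension of `diagFun` cancel along each
orbit. -/
theorem sum_zeroExtension_diagFun_shear [Fintype F] (hmn : m ≤ n) {y : Fin m → F} {j : Fin m}
    (hj : y j ≠ 0) (U : MSubspace F V m) :
    ∑ c : F, zeroExtension b W hW (diagFun F hmn)
      (mapMSubspace (shear b (c • Pi.single (Fin.castLE hmn j) 1) y) U) = 0 := by
  by_cases hU : U.1 ⊓ W = ⊥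
  · obtain ⟨M, rfl⟩ := (range_matrixSubspace b W hW U).2 hU
    rw [← sum_diagFun_add_smul hmn M hj]
    refine Finset.sum_congr rfl fun c _ => ?_
    rw [← Matrix.smul_vecMulVec, ← zeroExtension_matrixSubspace b hW (diagFun F hmn)]
    exact congrArg _ (Subtype.ext (map_shear_matrixSubspace b _ y M))
  · refine Finset.sum_eq_zero fun c _ => zeroExtension_of_inf_ne_bot b hW _ ?_
    -- the shear fixes `W` pointwise, so the image of `U` still contains `U ⊓ W`
    refine fun h => hU (eq_bot_mono (fun v hv => Submodule.mem_inf.2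
      ⟨(Submodule.mem_map (f := (shear b _ y).toLinearMap)).2 ⟨v, hv.1, ?_⟩, hv.2⟩) h)
    obtain ⟨-, hvW⟩ := hv
    rw [SetLike.mem_coe, ← hW, mem_span_inl] at hvW
    exact shear_apply_of_dotProduct_eq_zero b _ (by rw [hvW, dotProduct_zero])

theorem exists_dotProduct_eq_zero (H : Submodule F V) (hH : finrank F H + 1 = m) :
    ∃ y : Fin m → F, y ≠ 0 ∧ ∀ v ∈ H, y ⬝ᵥ (splitCoords b v).2 = 0 := by
  have : Module.Finite F V := Module.Finite.of_basis b
  let p : V →ₗ[F] (Fin m → F) := LinearMap.snd F _ _ ∘ₗ (splitCoords b).toLinearMap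
  have hlt : H.map p < ⊤ := by
    rw [lt_top_iff_ne_top]
    intro h
    have h1 := Submodule.finrank_map_le p H
    rw [h, finrank_top, Module.finrank_fin_fun] at h1
    omega
  obtain ⟨φ, hφ, hker⟩ := Submodule.exists_le_ker_of_lt_top _ hlt
  obtain ⟨y, rfl⟩ := (dotProductEquiv F (Fin m)).surjective φ
  exact ⟨y, by rintro rfl; simp at hφ, fun v hv => hker ⟨v, hv, rfl⟩⟩

/-- The extension of `diagFun` by zero is in the kernel of the incidence matrix: its sum over the
subspaces that contain `H` is invariant under the shears that fix `H` pointwise. -/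
theorem upSum_zeroExtension_diagFun [Finite F] [Fintype (MSubspace F V m)] (hmn : m ≤ n)
    {H : Submodule F V} (hH : finrank F H + 1 = m) :
    upSum (zeroExtension b W hW (diagFun F hmn)) H = 0 := by
  classical
  have := Fintype.ofFinite F
  obtain ⟨y, hy, hyH⟩ := exists_dotProduct_eq_zero b H hH
  obtain ⟨j, hj⟩ := Function.ne_iff.1 hy
  set g := zeroExtension b W hW (diagFun F hmn)
  let τ (c : F) : MSubspace F V m ≃ MSubspace F V m :=
    mapMSubspace (shear b (c • Pi.single (Fin.castLE hmn j) 1) y)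
  have hτ (c : F) (U : MSubspace F V m) : H ≤ (τ c U).1 ↔ H ≤ U.1 := by
    have hfix : H.map (shear b (c • Pi.single (Fin.castLE hmn j) 1) y).toLinearMap = H :=
      map_eq_self_of_forall_apply_eq fun v hv =>
        shear_apply_of_dotProduct_eq_zero b _ (hyH v hv)
    nth_rw 1 [← hfix]
    exact Submodule.map_le_map_iff_of_injective (LinearEquiv.injective _) _ _
  have h (c : F) : upSum g H = ∑ U : MSubspace F V m, if H ≤ U.1 then g (τ c U) else 0 := by
    rw [upSum, ← (τ c).sum_comp]
    simp only [hτ]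
  have hsum : ∑ _c : F, upSum g H = 0 := by
    rw [Finset.sum_congr rfl fun c _ => h c, Finset.sum_comm]
    refine Finset.sum_eq_zero fun U _ => ?_
    split_ifs
    · exact sum_zeroExtension_diagFun_shear b hW hmn hj U
    · simp
  simpa using hsum

/-- Equality holds in the lower bound for the eigenvalues already in the bilinear forms graph. -/
theorem isEigenfunction_diagFun [Finite F] (hmn : m ≤ n) :
    IsEigenfunction (bilinearFormsGraph F n m) (-(hyperplaneCount F m : ℝ)) (diagFun F hmn) := by
  classical
  let b := (Pi.basisFun F (Fin n ⊕ Fin m))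
  have := Fintype.ofFinite (MSubspace F (Fin n ⊕ Fin m → F) m)
  have := Fintype.ofFinite (CoSubspace F (Fin n ⊕ Fin m → F) m)
  have := Fintype.ofFinite (Matrix (Fin n) (Fin m) F)
  rw [isEigenfunction_iff_sum]
  refine ⟨diagFun_ne_zero hmn, fun M => ?_⟩
  have h := sum_upSum (zeroExtension b _ rfl (diagFun F hmn)) (matrixSubspace b M)
  rw [sum_adj_zeroExtension, zeroExtension_matrixSubspace, Finset.sum_eq_zero fun H _ => by
    rw [upSum_zeroExtension_diagFun b rfl hmn H.2, ite_self]] at h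
  linarith

end Diagonal

/-! ### Minimum eigenfunctions extend by zero -/

theorem mainTheorem4 {F V : Type*} [Field F] [Finite F] [AddCommGroup V] [Module F V] [Finite V]
    (n m : ℕ) (hmn : m ≤ n) (W : Submodule F V) (b : Basis (Fin n ⊕ Fin m) F V)
    (hW : Submodule.span F (Set.range fun i => b (Sum.inl i)) = W)
    (θ : ℝ) (hθ : IsMinEigenvalue (bilinearFormsGraph F n m) θ)
    (f : Matrix (Fin n) (Fin m) F → ℝ) (hf : IsEigenfunction (bilinearFormsGraph F n m) θ f) :
    IsMinEigenvalue (grassmannGraph F V m) θ ∧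
      IsEigenfunction (grassmannGraph F V m) θ (zeroExtension b W hW f) := by
  classical
  have := Fintype.ofFinite (MSubspace F V m)
  have := Fintype.ofFinite (CoSubspace F V m)
  have := Fintype.ofFinite (Matrix (Fin n) (Fin m) F)
  have hle : θ ≤ -(hyperplaneCount F m : ℝ) := hθ.2 ⟨_, isEigenfunction_diagFun hmn⟩
  rw [isEigenfunction_iff_sum] at hf
  obtain ⟨hf0, hf⟩ := hf
  set g := zeroExtension b W hW f
  -- outside the subspaces `M̄` the factor `g U` vanishes, so the eigenvalue equation is only
  -- needed at the `M̄`
  have hg (U : MSubspace F V m) : g U * (hyperplaneCount F m * g U +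
      ∑ U', if (grassmannGraph F V m).Adj U U' then g U' else 0) =
        (hyperplaneCount F m + θ) * g U ^ 2 := by
    by_cases hU : U.1 ⊓ W = ⊥
    · obtain ⟨M, rfl⟩ := (range_matrixSubspace b W hW U).2 hU
      rw [sum_adj_zeroExtension, ← hf M, ← zeroExtension_matrixSubspace b hW f M]
      ring
    · have hgU : g U = 0 := zeroExtension_of_inf_ne_bot b hW f hU
      rw [hgU]
      ring
  have hsq : ∑ H : CoSubspace F V m, upSum g H.1 ^ 2 ≤ 0 := by
    rw [sum_upSum_sq, Finset.sum_congr rfl fun U _ => hg U, ← Finset.mul_sum]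
    exact mul_nonpos_of_nonpos_of_nonneg (by linarith) (Finset.sum_nonneg fun _ _ => sq_nonneg _)
  have hup (H : CoSubspace F V m) : upSum g H.1 = 0 := by
    have h0 := le_antisymm hsq (Finset.sum_nonneg fun _ _ => sq_nonneg _)
    rw [Finset.sum_eq_zero_iff_of_nonneg fun _ _ => sq_nonneg _] at h0
    exact pow_eq_zero_iff two_ne_zero |>.1 (h0 H (Finset.mem_univ _))
  have hG : IsEigenfunction (grassmannGraph F V m) (-(hyperplaneCount F m : ℝ)) g := by
    rw [isEigenfunction_iff_sum]
    refine ⟨zeroExtension_ne_zero b hW hf0, fun U => ?_⟩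
    have h := sum_upSum g U
    rw [Finset.sum_eq_zero fun H _ => by rw [hup, ite_self]] at h
    linarith
  have hθ' : θ = -(hyperplaneCount F m : ℝ) := by
    obtain ⟨M, hM⟩ := Function.ne_iff.1 hf0
    have h := ((isEigenfunction_iff_sum _ _ _).1 hG).2 (matrixSubspace b M)
    rw [sum_adj_zeroExtension, ← hf M,
      show g (matrixSubspace b M) = f M from zeroExtension_matrixSubspace b hW f M] at h
    exact (mul_right_cancel₀ hM h).symm
  rw [hθ']
  exact ⟨⟨⟨g, hG⟩, fun μ ⟨h, hh⟩ => neg_hyperplaneCount_le_of_isEigenfunction hh⟩, hG⟩
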